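/- Let $r \ge 2$. An $r$-graph is a set of $r$-element subsets (edges) of a finite vertex set; $\alpha(H)$ denotes the maximum size of a set of vertices of $H$ containing no edge (an independent set). An $r$-graph $H$ has independent neighborhoods if for every set $R$ of $r-1$ vertices the set $\{v \notin R : R \cup \{v\} \in H\}$ is independent. Let $T_r$ be the $r$-graph with vertex set $R \cup S$, where $R \cap S = \emptyset$, $|R| = r$, $|S| = r-1$, whose edges are all $r$-subsets of $R \cup S$ containing $S$, together with $R$. Let $K_t^{(r)}$ be the complete $r$-graph on $t$ vertices, and let $R(T_r, K_t^{(r)})$ be the minimum $N$ such that every red-blue coloring of the edges of $K_N^{(r)}$ contains a red $T_r$ or a blue $K_t^{(r)}$. 1. An $r$-graph has independent neighborhoods if and only if it contains no copy of $T_r$ as a (not necessarily induced) subgraph. 2. There is a constant $c > 0$, depending only on $r$, such that every $n$-vertex $r$-graph $H$ with independent neighborhoods satisfies $$\alpha(H) \ge c\,(n \log n)^{1/r}$$ (where $n\log n$ is read as $0$ for $n=0$). 3. Consequently $R(T_r, K_t^{(r)})$ exists for every $t \ge 2$ and $R(T_r, K_t^{(r)}) = O(t^r/\log t)$; that is, there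 is a constant $C > 0$, depending only on $r$, such that $R(T_r, K_t^{(r)}) \le C\, t^r/\log t$ for all $t \ge 2$. -/

import Mathlib

namespace Hypergraph

/-- `H` is an `r`-graph: it has finitely many vertices and every edge has exactly `r` elements. -/
def IsRGraph {α : Type*} (r : ℕ) (H : Hypergraph α) : Prop :=
  V(H).Finite ∧ ∀ e ∈ E(H), e.ncard = r

/-- `Z` is a set of vertices of `H` containing no edge of `H`. -/
def IsIndepSet {α : Type*} (H : Hypergraph α) (Z : Set α) : Prop :=
  Z ⊆ V(H) ∧ ∀ e ∈ E(H), ¬ e ⊆ Z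

/-- The independence number `α(H)`: the maximum size of an independent set
(used only for hypergraphs with finitely many vertices). -/
noncomputable def indepNum {α : Type*} (H : Hypergraph α) : ℕ :=
  sSup {k : ℕ | ∃ Z : Set α, H.IsIndepSet Z ∧ Z.ncard = k}

/-- The neighborhood of a vertex set `R`: the union of the sets `e \ R` over the edges `e ⊇ R`. -/
def nbhd {α : Type*} (H : Hypergraph α) (R : Set α) : Set α :=
  {v | ∃ e ∈ E(H), R ⊆ e ∧ v ∈ e \ R}

/-- The neighborhood of every set of `r - 1` vertices is independent (for an `r`-graph, `r ≥ 1`). -/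
def HasIndepNbhds {α : Type*} (r : ℕ) (H : Hypergraph α) : Prop :=
  ∀ R : Set α, R ⊆ V(H) → R.ncard = r - 1 → H.IsIndepSet (H.nbhd R)

/-- `H` contains a copy of `F` as a (not necessarily induced) subgraph. -/
def Contains {α β : Type*} (H : Hypergraph α) (F : Hypergraph β) : Prop :=
  ∃ f : β → α, Set.InjOn f V(F) ∧ V(F.image f) ⊆ V(H) ∧ E(F.image f) ⊆ E(H)

/-- The `r`-graph `T_r`: its vertex set is the disjoint union of a set `R` of size `r`
(the left summand) and a set `S` of size `r - 1` (the right summand), and its edges are all the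
`r`-sets containing `S`, together with `R`. -/
def T (r : ℕ) : Hypergraph (Fin r ⊕ Fin (r - 1)) where
  vertexSet := Set.univ
  edgeSet := {e | e.ncard = r ∧ Set.range Sum.inr ⊆ e} ∪ {Set.range Sum.inl}
  subset_vertexSet_of_mem_edgeSet' := fun _ _ => Set.subset_univ _

/-- The complete `r`-graph `K_N^{(r)}` on `N` vertices. -/
def completeRGraph (r N : ℕ) : Hypergraph (Fin N) where
  vertexSet := Set.univ
  edgeSet := {e | e.ncard = r}
  subset_vertexSet_of_mem_edgeSet' := fun _ _ => Set.subset_univ _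

/-- The subgraph of all edges that receive colour `i`, on the same vertex set. -/
def colorClass {α κ : Type*} (H : Hypergraph α) (c : E(H) → κ) (i : κ) : Hypergraph α where
  vertexSet := V(H)
  edgeSet := {e | ∃ he : e ∈ E(H), c ⟨e, he⟩ = i}
  subset_vertexSet_of_mem_edgeSet' := fun _ he => he.1.subset_vertexSet

/-- The set of `N` such that every red-blue coloring (`true` is red, `false` is blue) of the edges
of `K_N^{(r)}` has a red copy of `F` or a blue copy of `G`. -/
def ramseySet {β γ : Type*} (r : ℕ) (F : Hypergraph β) (G : Hypergraph γ) : Set ℕ :=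
  {N | ∀ c : E(completeRGraph r N) → Bool,
    ((completeRGraph r N).colorClass c true).Contains F ∨
    ((completeRGraph r N).colorClass c false).Contains G}

/-- The Ramsey number `R(F, G)` of two `r`-graphs, the minimum of `ramseySet r F G`
(meaningful when that set is nonempty). -/
noncomputable def ramseyNumber {β γ : Type*} (r : ℕ) (F : Hypergraph β) (G : Hypergraph γ) : ℕ :=
  sInf (ramseySet r F G)

end Hypergraph

/-! Write b = r - 1, a = α(H), n = |V|. The edges through a b-set correspond to the vertices of its
neighborhood, which is independent, so every codegree is at most a. What has to be shown is n log n
= O(a^r).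

The method counts independent sets, in the style of Shearer. Keep each vertex with probability p to
get U, let W be a uniformly random independent subset of U, and for v ∉ U let P(U,v) be the
probability that W + v is independent.

Upper bound (`sum_weight_extendable_le`): adding v at most doubles the number of independent sets,
so P(U,v) is at most twice the probability that v lies in a random independent subset of U + v.
Passing from (U,v) to (U + v,v), the expected sum of P(U,v) over v is at most 2a/p.

Lower bound (`le_card_extendable`): suppose each edge inside U meets the link of v in at most one
vertex. Given W outside the link, W on the link is a uniform subset of the vertices still free, and
correlation of decreasing events gives P(U,v) ≥ e^(-L) (1 + L - κ E[number of link edges of v in W])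
for every L. Summed over v, a fixed W contains at most a^b · a link edges.

Together (`global_inequality`) these give (n/4)(1 + L) ≤ κ a^r + e^L · 2a/p, and e^L = pn/(8a)
yields n log(pn/(8a)) = O(a^r). Local sparsity is automatic for r = 2; for r ≥ 3 a first moment
bound (`sum_weight_not_locallySparse_le_half`) gives it when pn = (n log n)^(1/r) n^δ with δ small,
and then the logarithm is still of order log n.

For the Ramsey bound, a red class without T_r has independent neighborhoods, and its large
independent set is a blue clique. -/

namespace FinsetFamily
open Finset
variable {α : Type*} [DecidableEq α]

/-- The subsets of `U` that contain no member of `E`. -/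
def indepSets (E : Finset (Finset α)) (U : Finset α) : Finset (Finset α) :=
  {W ∈ U.powerset | ∀ e ∈ E, ¬ e ⊆ W}

/-- The members of `E` through `v` all of whose other vertices lie in `W`. -/
def linkIn (E : Finset (Finset α)) (v : α) (W : Finset α) : Finset (Finset α) :=
  {e ∈ E | v ∈ e ∧ e.erase v ⊆ W}

/-- The independent subsets of `U` that stay independent when `v` is added. -/
def extendable (E : Finset (Finset α)) (U : Finset α) (v : α) : Finset (Finset α) :=
  {W ∈ indepSets E U | linkIn E v W = ∅}

/-- The vertices of `U` lying on an edge through `v` whose other vertices are in `U`. -/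
def linkVerts (E : Finset (Finset α)) (U : Finset α) (v : α) : Finset α :=
  {x ∈ U | ∃ e ∈ linkIn E v U, x ∈ e}

/-- Every edge inside `U` meets the link of `v` in at most one vertex. -/
def LocallySparse (E : Finset (Finset α)) (U : Finset α) (v : α) : Prop :=
  ∀ f ∈ E, f ⊆ U → ∀ x ∈ f, ∀ y ∈ f, x ∈ linkVerts E U v → y ∈ linkVerts E U v → x = y

/-! ### Adding one vertex: the recursion for the number of independent sets -/

variable {E : Finset (Finset α)} {U V W : Finset α} {v : α}

theorem mem_indepSets : W ∈ indepSets E U ↔ W ⊆ U ∧ ∀ e ∈ E, ¬ e ⊆ W := by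
  simp [indepSets]

theorem mem_extendable :
    W ∈ extendable E U v ↔ W ⊆ U ∧ insert v W ∈ indepSets E (insert v U) := by
  simp only [extendable, linkIn, mem_filter, mem_indepSets, filter_eq_empty_iff, not_and]
  constructor
  · rintro ⟨⟨h1, h2⟩, h3⟩
    refine ⟨h1, insert_subset_insert _ h1, fun e he hs => ?_⟩
    by_cases hve : v ∈ e
    · exact h3 he hve (subset_insert_iff.1 hs)
    · exact h2 e he ((subset_insert_iff_of_notMem hve).1 hs)
  · rintro ⟨h1, -, h2⟩
    exact ⟨⟨h1, fun e he hs => h2 e he (hs.trans (subset_insert _ _))⟩,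
      fun e he _ hs => h2 e he (subset_insert_iff.2 hs)⟩

theorem card_filter_mem_indepSets_insert (hv : v ∉ U) :
    #{W ∈ indepSets E (insert v U) | v ∈ W} = #(extendable E U v) := by
  refine card_bij' (fun W _ => W.erase v) (fun W _ => insert v W) ?_ ?_ ?_ ?_
  · intro W hW
    obtain ⟨hW, hvW⟩ := mem_filter.1 hW
    rw [mem_extendable, insert_erase hvW]
    exact ⟨subset_insert_iff.1 (mem_indepSets.1 hW).1, hW⟩
  · intro W hW
    exact mem_filter.2 ⟨(mem_extendable.1 hW).2, mem_insert_self _ _⟩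
  · intro W hW
    exact insert_erase (mem_filter.1 hW).2
  · intro W hW
    exact erase_insert fun h => hv ((mem_extendable.1 hW).1 h)

theorem card_indepSets_insert (hv : v ∉ U) :
    #(indepSets E (insert v U)) = #(indepSets E U) + #(extendable E U v) := by
  rw [← card_filter_mem_indepSets_insert hv, add_comm,
    ← card_filter_add_card_filter_not (s := indepSets E (insert v U)) (fun W => v ∈ W)]
  congr 2
  ext W
  simp only [mem_filter, mem_indepSets]
  constructor
  · rintro ⟨⟨h1, h2⟩, h3⟩
    exact ⟨(subset_insert_iff_of_notMem h3).1 h1, h2⟩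
  · rintro ⟨h1, h2⟩
    exact ⟨⟨h1.trans (subset_insert _ _), h2⟩, fun h => hv (h1 h)⟩

theorem card_extendable_le : #(extendable E U v) ≤ #(indepSets E U) :=
  card_le_card (filter_subset _ _)

theorem card_indepSets_pos (hE : ∀ e ∈ E, e.Nonempty) : 0 < #(indepSets E U) := by
  refine card_pos.2 ⟨∅, mem_indepSets.2 ⟨empty_subset _, fun e he h => ?_⟩⟩
  exact (hE e he).ne_empty (subset_empty.1 h)

/-! ### Sets avoiding a family of events -/

theorem card_filter_subset_powerset {R X : Finset α} (h : R ⊆ X) :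
    (#{S ∈ X.powerset | R ⊆ S} : ℝ) = 2 ^ #X * (1 / 2) ^ #R := by
  have h1 : {S ∈ X.powerset | R ⊆ S} = Icc R X := by
    ext S; simp [and_comm]
  rw [h1, card_Icc_finset h]
  have h2 : (2 : ℝ) ^ #X = 2 ^ (#X - #R) * 2 ^ #R := by
    rw [← pow_add, Nat.sub_add_cancel (card_le_card h)]
  rw [h2, mul_assoc, ← mul_pow]
  norm_num

/-- Each condition defines a lower set of subsets of X. By the Harris–Kleitman inequality lower sets
are positively correlated, so the avoidance probability is at least that of independent events, even
when the sets `R i` overlap. -/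
theorem le_card_avoiding {ι : Type*} (X : Finset α) (b : ℕ) (F : Finset ι) (R : ι → Finset α)
    (hR : ∀ i ∈ F, R i ⊆ X) (hb : ∀ i ∈ F, #(R i) = b) :
    (2 : ℝ) ^ #X * (1 - (1 / 2) ^ b) ^ #F ≤ #{S ∈ X.powerset | ∀ i ∈ F, ¬ R i ⊆ S} := by
  classical
  induction F using Finset.induction_on with
  | empty => simp
  | insert i F hi ih =>
    have ih := ih (fun j hj => hR j (mem_insert_of_mem hj)) fun j hj => hb j (mem_insert_of_mem hj)
    set A := {S ∈ X.powerset | ∀ j ∈ F, ¬ R j ⊆ S}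
    set B := {S ∈ X.powerset | ¬ R i ⊆ S} with hB
    have hAB : {S ∈ X.powerset | ∀ j ∈ insert i F, ¬ R j ⊆ S} = A ∩ B := by
      ext S
      simp only [A, B, mem_filter, mem_inter, forall_mem_insert]
      tauto
    have hA : IsLowerSet (A : Set (Finset α)) := by
      intro S T hTS hS
      simp only [A, coe_filter, Set.mem_ofPred_eq, mem_powerset] at hS ⊢
      exact ⟨hTS.trans hS.1, fun j hj h => hS.2 j hj (h.trans hTS)⟩
    have hB' : IsLowerSet (B : Set (Finset α)) := by
      intro S T hTS hS
      simp only [B, coe_filter, Set.mem_ofPred_eq, mem_powerset] at hS ⊢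
      exact ⟨hTS.trans hS.1, fun h => hS.2 (h.trans hTS)⟩
    have hHK := hA.le_card_inter_finset' hB' (s := X)
      (fun t ht => mem_powerset.1 (mem_filter.1 ht).1)
      (fun t ht => mem_powerset.1 (mem_filter.1 ht).1)
    have hHK' : (#A : ℝ) * #B ≤ 2 ^ #X * #(A ∩ B) := by exact_mod_cast hHK
    have hcard : (#B : ℝ) = 2 ^ #X * (1 - (1 / 2) ^ b) := by
      have h1 := card_filter_add_card_filter_not (s := X.powerset) (fun S => R i ⊆ S)
      have h2 := card_filter_subset_powerset (hR i (mem_insert_self _ _))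
      rw [hb i (mem_insert_self _ _)] at h2
      rw [card_powerset] at h1
      have h3 : (#{S ∈ X.powerset | R i ⊆ S} : ℝ) + #B = 2 ^ #X := by
        rw [hB]; exact_mod_cast h1
      linarith
    rw [hAB, card_insert_of_notMem hi, pow_succ]
    rw [hcard] at hHK'
    have hq : (0 : ℝ) ≤ 1 - (1 / 2) ^ b := by
      have : ((1 : ℝ) / 2) ^ b ≤ 1 := pow_le_one₀ (by norm_num) (by norm_num)
      linarith
    have hpos : (0 : ℝ) < 2 ^ #X := by positivity
    refine le_of_mul_le_mul_left ?_ hpos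
    calc _ = ((2 : ℝ) ^ #X * (1 - (1 / 2) ^ b) ^ #F) * (2 ^ #X * (1 - (1 / 2) ^ b)) := by ring
      _ ≤ #A * (2 ^ #X * (1 - (1 / 2) ^ b)) := by gcongr
      _ ≤ _ := hHK'

/-! ### The local inequality -/

/-- The vertices of `N` that can be added to `Y`. -/
def freeVerts (E : Finset (Finset α)) (N Y : Finset α) : Finset α :=
  {x ∈ N | ∀ e ∈ E, ¬ e ⊆ insert x Y}

/-- Split W into Y = W \ N and S = W ∩ N. An edge inside Y ∪ S uses at most one vertex of S, so it
is excluded as soon as each vertex of S is individually addable to Y. Hence the fibre over Y is a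
full power set, and S is uniform on it. -/
theorem sum_indepSets_eq_sum_freeVerts {N : Finset α} (hNU : N ⊆ U)
    (hN : ∀ f ∈ E, f ⊆ U → ∀ x ∈ f, ∀ y ∈ f, x ∈ N → y ∈ N → x = y) (F : Finset α → ℝ) :
    ∑ W ∈ indepSets E U, F W =
      ∑ Y ∈ indepSets E (U \ N), ∑ S ∈ (freeVerts E N Y).powerset, F (Y ∪ S) := by
  rw [sum_sigma']
  refine sum_bij' (fun W _ => ⟨W \ N, W ∩ N⟩) (fun YS _ => YS.1 ∪ YS.2) ?_ ?_ ?_ ?_ ?_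
  · intro W hW
    obtain ⟨h1, h2⟩ := mem_indepSets.1 hW
    simp only [mem_sigma, mem_indepSets, mem_powerset]
    refine ⟨⟨sdiff_subset_sdiff h1 le_rfl, fun e he h => h2 e he (h.trans sdiff_subset)⟩, ?_⟩
    intro x hx
    rw [mem_inter] at hx
    refine mem_filter.2 ⟨hx.2, fun e he h => h2 e he (h.trans ?_)⟩
    exact insert_subset hx.1 sdiff_subset
  · rintro ⟨Y, S⟩ h
    simp only [mem_sigma, mem_indepSets, mem_powerset] at h
    obtain ⟨⟨h1, h2⟩, h3⟩ := h
    have hSN : S ⊆ N := h3.trans (filter_subset _ _)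
    have hsub : Y ∪ S ⊆ U := union_subset (h1.trans sdiff_subset) (hSN.trans hNU)
    refine mem_indepSets.2 ⟨hsub, fun e he h => ?_⟩
    by_cases hx : ∃ x ∈ e, x ∈ S
    · obtain ⟨x, hxe, hxS⟩ := hx
      refine (mem_filter.1 (h3 hxS)).2 e he fun y hy => ?_
      rcases mem_union.1 (h hy) with hyY | hyS
      · exact mem_insert_of_mem hyY
      · rw [hN e he (h.trans hsub) y hy x hxe (hSN hyS) (hSN hxS)]
        exact mem_insert_self _ _
    · push Not at hx
      exact h2 e he fun y hy => (mem_union.1 (h hy)).resolve_right (hx y hy)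
  · intro W hW
    exact sdiff_union_inter W N
  · rintro ⟨Y, S⟩ h
    simp only [mem_sigma, mem_indepSets, mem_powerset] at h
    obtain ⟨⟨h1, h2⟩, h3⟩ := h
    have hSN : S ⊆ N := h3.trans (filter_subset _ _)
    have hYN : ∀ y ∈ Y, y ∉ N := fun y hy => (mem_sdiff.1 (h1 hy)).2
    have e1 : (Y ∪ S) \ N = Y := by ext y; grind
    have e2 : (Y ∪ S) ∩ N = S := by ext y; grind
    simp only [e1, e2]
  · intro W hW
    rw [sdiff_union_inter]

/-- The constant of the local inequality for link edges with `b` vertices. -/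
noncomputable def linkConst (b : ℕ) : ℝ := -(2 ^ b * Real.log (1 - (1 / 2) ^ b))

/-- It suffices to compare both sides for each Y. There the mean number of link edges is |F| / 2^b,
while the chance of having none is at least q^|F| with q = 1 - 2^(-b); `linkConst b` is the factor
turning |F| log q into a multiple of that mean. -/
theorem le_card_extendable {b : ℕ} (hb : 1 ≤ b) (hE : ∀ e ∈ E, #e = b + 1)
    (hs : LocallySparse E U v) (L : ℝ) :
    Real.exp (-L) * ((1 + L) * #(indepSets E U) -
      linkConst b * ∑ W ∈ indepSets E U, (#(linkIn E v W) : ℝ)) ≤ #(extendable E U v) := by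
  set N := linkVerts E U v with hNdef
  have hNU : N ⊆ U := filter_subset _ _
  have hlinkN : ∀ e ∈ linkIn E v U, e.erase v ⊆ N := by
    intro e he x hx
    have he' := (mem_filter.1 he).2
    exact mem_filter.2 ⟨he'.2 hx, e, he, mem_of_mem_erase hx⟩
  set q : ℝ := 1 - (1 / 2) ^ b with hq
  have hq0 : 0 < q := by
    have : ((1 : ℝ) / 2) ^ b < 1 := pow_lt_one₀ (by norm_num) (by norm_num) (by lia)
    linarith
  have hcard : (#(indepSets E U) : ℝ) = ∑ W ∈ indepSets E U, 1 := by simp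
  have hext : (#(extendable E U v) : ℝ) =
      ∑ W ∈ indepSets E U, if linkIn E v W = ∅ then 1 else 0 := by
    rw [extendable, card_filter]; push_cast; rfl
  rw [hcard, hext, sum_indepSets_eq_sum_freeVerts hNU hs,
    sum_indepSets_eq_sum_freeVerts hNU hs, sum_indepSets_eq_sum_freeVerts hNU hs,
    mul_sum, mul_sum, ← sum_sub_distrib, mul_sum]
  refine sum_le_sum fun Y hY => ?_
  set X := freeVerts E N Y with hX
  have hXN : X ⊆ N := filter_subset _ _
  have hYU := (mem_indepSets.1 hY).1
  set F := {e ∈ linkIn E v U | e.erase v ⊆ X} with hF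
  have hlink : ∀ S ∈ X.powerset, linkIn E v (Y ∪ S) = {e ∈ F | e.erase v ⊆ S} := by
    intro S hS
    rw [mem_powerset] at hS
    ext e
    simp only [hF, mem_filter]
    constructor
    · intro he
      obtain ⟨heE, hve, hsub⟩ := mem_filter.1 he
      have heU : e ∈ linkIn E v U := mem_filter.2 ⟨heE, hve, hsub.trans
        (union_subset (hYU.trans sdiff_subset) (hS.trans (hXN.trans hNU)))⟩
      have : e.erase v ⊆ S := by
        intro x hx
        refine (mem_union.1 (hsub hx)).resolve_left fun hxY => ?_
        exact (mem_sdiff.1 (hYU hxY)).2 (hlinkN e heU hx)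
      exact ⟨⟨heU, this.trans hS⟩, this⟩
    · rintro ⟨⟨heU, -⟩, hsub⟩
      obtain ⟨heE, hve, -⟩ := mem_filter.1 heU
      exact mem_filter.2 ⟨heE, hve, hsub.trans subset_union_right⟩
  have hFb : ∀ e ∈ F, #(e.erase v) = b := by
    intro e he
    obtain ⟨heE, hve, -⟩ := mem_filter.1 (mem_filter.1 he).1
    rw [card_erase_of_mem hve, hE e heE]; simp
  have hFX : ∀ e ∈ F, e.erase v ⊆ X := fun e he => (mem_filter.1 he).2
  have hsum1 : ∑ S ∈ X.powerset, (1 : ℝ) = 2 ^ #X := by simp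
  have hsum2 : ∑ S ∈ X.powerset, (#(linkIn E v (Y ∪ S)) : ℝ) = #F * (2 ^ #X * (1 / 2) ^ b) := by
    calc _ = ∑ S ∈ X.powerset, ∑ e ∈ F, (if e.erase v ⊆ S then (1 : ℝ) else 0) := by
          refine sum_congr rfl fun S hS => ?_
          rw [hlink S hS, card_filter]; push_cast; rfl
      _ = ∑ e ∈ F, ∑ S ∈ X.powerset, (if e.erase v ⊆ S then (1 : ℝ) else 0) := sum_comm
      _ = ∑ e ∈ F, (2 ^ #X * (1 / 2) ^ b : ℝ) := by
          refine sum_congr rfl fun e he => ?_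
          rw [← hFb e he, ← card_filter_subset_powerset (hFX e he), card_filter]; push_cast; rfl
      _ = _ := by simp
  have hsum3 : (2 : ℝ) ^ #X * q ^ #F ≤
      ∑ S ∈ X.powerset, if linkIn E v (Y ∪ S) = ∅ then (1 : ℝ) else 0 := by
    refine (le_card_avoiding X b F (fun e => e.erase v) hFX hFb).trans (le_of_eq ?_)
    rw [card_filter]; push_cast
    refine sum_congr rfl fun S hS => ?_
    simp only [hlink S hS, filter_eq_empty_iff]
  refine le_trans ?_ hsum3
  rw [hsum1, hsum2, linkConst, ← hq]
  have h2 : (2 : ℝ) ^ b * (1 / 2) ^ b = 1 := by rw [← mul_pow]; norm_num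
  have hqe : q ^ #F = Real.exp (-L) * Real.exp (L + #F * Real.log q) := by
    rw [← Real.exp_add, neg_add_cancel_left, Real.exp_nat_mul, Real.exp_log hq0]
  -- The tangent line makes the bound linear in |F|, so that it can be averaged over Y; the free
  -- parameter L is optimised only after summing over v.
  have htan := Real.add_one_le_exp (L + #F * Real.log q)
  rw [hqe]
  calc _ = 2 ^ #X * (Real.exp (-L) *
        (1 + L + #F * Real.log q * ((2 : ℝ) ^ b * (1 / 2) ^ b))) := by ring
    _ ≤ _ := by
      rw [h2]
      gcongr
      linarith

end FinsetFamily

namespace FinsetFamily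
open Finset
variable {α : Type*} {E : Finset (Finset α)} {U V W : Finset α} {v : α}

/-! ### Random subsets -/

/-- The probability of `U` when each element of `V` is kept independently with probability `p`. -/
noncomputable def weight (V : Finset α) (p : ℝ) (U : Finset α) : ℝ :=
  p ^ #U * (1 - p) ^ (#V - #U)

variable {p : ℝ}

theorem weight_nonneg (hp : 0 ≤ p) (hp1 : p ≤ 1) : 0 ≤ weight V p U :=
  mul_nonneg (pow_nonneg hp _) (pow_nonneg (sub_nonneg.2 hp1) _)

theorem sum_weight : ∑ U ∈ V.powerset, weight V p U = 1 := by
  simp [weight, sum_pow_mul_eq_add_pow]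

variable [DecidableEq α]

theorem sum_weight_superset {S : Finset α} (hS : S ⊆ V) :
    ∑ U ∈ V.powerset with S ⊆ U, weight V p U = p ^ #S := by
  have h : ∑ U ∈ V.powerset with S ⊆ U, weight V p U =
      ∑ T ∈ (V \ S).powerset, p ^ #S * weight (V \ S) p T := by
    refine sum_bij' (fun U _ => U \ S) (fun T _ => S ∪ T) ?_ ?_ ?_ ?_ ?_
    · intro U hU
      simp only [mem_filter, mem_powerset] at hU ⊢
      exact sdiff_subset_sdiff hU.1 le_rfl
    · intro T hT
      simp only [mem_filter, mem_powerset] at hT ⊢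
      exact ⟨union_subset hS (hT.trans sdiff_subset), subset_union_left⟩
    · intro U hU
      exact union_sdiff_of_subset (mem_filter.1 hU).2
    · intro T hT
      rw [mem_powerset] at hT
      exact union_sdiff_cancel_left (disjoint_of_subset_right hT disjoint_sdiff)
    · intro U hU
      simp only [mem_filter, mem_powerset] at hU
      have h1 : #(U \ S) + #S = #U := card_sdiff_add_card_eq_card hU.2
      have h2 : #(V \ S) + #S = #V := card_sdiff_add_card_eq_card hS
      have h3 : #V - #U = #(V \ S) - #(U \ S) := by lia
      rw [weight, weight, ← mul_assoc, ← pow_add, h3, add_comm, h1]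
  rw [h, ← mul_sum, sum_weight, mul_one]

/-- The bijection (U, v) ↦ (U + v, v) moves v from outside to inside, which changes the weight by
the factor p / (1 - p). -/
theorem sum_weight_exchange (g : Finset α → α → ℝ) :
    p * ∑ U ∈ V.powerset, weight V p U * ∑ v ∈ V \ U, g U v =
      (1 - p) * ∑ U ∈ V.powerset, weight V p U * ∑ v ∈ U, g (U.erase v) v := by
  simp only [mul_sum]
  rw [sum_sigma', sum_sigma']
  refine sum_bij' (fun x _ => ⟨insert x.2 x.1, x.2⟩) (fun x _ => ⟨x.1.erase x.2, x.2⟩) ?_ ?_ ?_ ?_ ?_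
  · rintro ⟨U, v⟩ h
    simp only [mem_sigma, mem_powerset, mem_sdiff] at h ⊢
    exact ⟨insert_subset h.2.1 h.1, mem_insert_self _ _⟩
  · rintro ⟨U, v⟩ h
    simp only [mem_sigma, mem_powerset, mem_sdiff] at h ⊢
    exact ⟨(erase_subset _ _).trans h.1, h.1 h.2, notMem_erase _ _⟩
  · rintro ⟨U, v⟩ h
    simp only [mem_sigma, mem_powerset, mem_sdiff] at h
    simp [erase_insert h.2.2]
  · rintro ⟨U, v⟩ h
    simp only [mem_sigma, mem_powerset] at h
    simp [insert_erase h.2]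
  · rintro ⟨U, v⟩ h
    simp only [mem_sigma, mem_powerset, mem_sdiff] at h
    have h1 : #(insert v U) ≤ #V := card_le_card (insert_subset h.2.1 h.1)
    rw [card_insert_of_notMem h.2.2] at h1
    have h2 : #V - #U = (#V - (#U + 1)) + 1 := by lia
    simp only [erase_insert h.2.2, weight, card_insert_of_notMem h.2.2]
    rw [h2, pow_succ, pow_succ]
    ring

/-- After the exchange, the sum over v ∈ U of the probabilities that v lies in a random independent
set is the mean size of that set, hence at most a. -/
theorem sum_weight_extendable_le (hE : ∀ e ∈ E, e.Nonempty) (hp : 0 ≤ p) (hp1 : p ≤ 1) {a : ℕ}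
    (ha : ∀ W ∈ indepSets E V, #W ≤ a) :
    p * ∑ U ∈ V.powerset, weight V p U *
      ∑ v ∈ V \ U, (#(extendable E U v) : ℝ) / #(indepSets E U) ≤ 2 * a := by
  have hpos : ∀ U : Finset α, (0 : ℝ) < #(indepSets E U) := fun U => by
    exact_mod_cast card_indepSets_pos hE
  have h1 : ∀ U ∈ V.powerset, ∑ v ∈ V \ U, (#(extendable E U v) : ℝ) / #(indepSets E U) ≤
      ∑ v ∈ V \ U, 2 * ((#(extendable E U v) : ℝ) / #(indepSets E (insert v U))) := by
    intro U hU
    refine sum_le_sum fun v hv => ?_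
    have hle : (#(indepSets E (insert v U)) : ℝ) ≤ 2 * #(indepSets E U) := by
      rw [card_indepSets_insert (mem_sdiff.1 hv).2]
      have : (#(extendable E U v) : ℝ) ≤ #(indepSets E U) := by exact_mod_cast card_extendable_le
      push_cast
      linarith
    have hx : (0 : ℝ) ≤ #(extendable E U v) := by positivity
    rw [← mul_div_assoc, div_le_div_iff₀ (hpos _) (hpos _)]
    nlinarith
  have h2 : ∀ U ∈ V.powerset, ∑ v ∈ U,
      2 * ((#(extendable E (U.erase v) v) : ℝ) / #(indepSets E (insert v (U.erase v)))) ≤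
        2 * a := by
    intro U hU
    have h3 : ∀ v ∈ U, 2 * ((#(extendable E (U.erase v) v) : ℝ) /
        #(indepSets E (insert v (U.erase v)))) =
        2 / #(indepSets E U) * ∑ W ∈ indepSets E U, if v ∈ W then (1 : ℝ) else 0 := by
      intro v hv
      rw [← card_filter_mem_indepSets_insert (notMem_erase v U), insert_erase hv, card_filter]
      push_cast
      ring
    rw [sum_congr rfl h3, ← mul_sum, sum_comm]
    have h4 : ∑ W ∈ indepSets E U, ∑ v ∈ U, (if v ∈ W then (1 : ℝ) else 0) ≤
        ∑ W ∈ indepSets E U, (a : ℝ) := by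
      refine sum_le_sum fun W hW => ?_
      obtain ⟨hWU, hWE⟩ := mem_indepSets.1 hW
      have : #{v ∈ U | v ∈ W} ≤ a := by
        refine (card_le_card fun x hx => (mem_filter.1 hx).2).trans
          (ha W (mem_indepSets.2 ⟨hWU.trans (mem_powerset.1 hU), hWE⟩))
      rw [card_filter] at this
      exact_mod_cast this
    calc _ ≤ 2 / #(indepSets E U) * ∑ W ∈ indepSets E U, (a : ℝ) := by gcongr
      _ = 2 * a := by
        have := (hpos U).ne'
        simp only [sum_const, nsmul_eq_mul]
        field_simp
  calc _ ≤ p * ∑ U ∈ V.powerset, weight V p U *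
      ∑ v ∈ V \ U, 2 * ((#(extendable E U v) : ℝ) / #(indepSets E (insert v U))) := by
        refine mul_le_mul_of_nonneg_left (sum_le_sum fun U hU => ?_) hp
        exact mul_le_mul_of_nonneg_left (h1 U hU) (weight_nonneg hp hp1)
    _ = (1 - p) * ∑ U ∈ V.powerset, weight V p U * ∑ v ∈ U,
      2 * ((#(extendable E (U.erase v) v) : ℝ) / #(indepSets E (insert v (U.erase v)))) :=
        sum_weight_exchange _
    _ ≤ (1 - p) * ∑ U ∈ V.powerset, weight V p U * (2 * a) := by
        refine mul_le_mul_of_nonneg_left (sum_le_sum fun U hU => ?_) (sub_nonneg.2 hp1)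
        exact mul_le_mul_of_nonneg_left (h2 U hU) (weight_nonneg hp hp1)
    _ ≤ 2 * a := by
        rw [← sum_mul, sum_weight]
        have : (0 : ℝ) ≤ a := by positivity
        nlinarith

/-! ### Counting with bounded codegree -/

variable {b d : ℕ}

/-- The pair (v, e) is recovered from e and its b-subset e - v of W; there are at most |W|^b such
subsets, each in at most d edges. -/
theorem sum_card_linkIn_le (hE : ∀ e ∈ E, #e = b + 1)
    (hd : ∀ R, #R = b → #{e ∈ E | R ⊆ e} ≤ d) (A W : Finset α) :
    ∑ v ∈ A, #(linkIn E v W) ≤ #W ^ b * d := by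
  have h1 : ∑ v ∈ A, #(linkIn E v W) ≤ ∑ R ∈ W.powersetCard b, #{e ∈ E | R ⊆ e} := by
    rw [← card_sigma, ← card_sigma]
    refine card_le_card_of_injOn (fun x => ⟨x.2.erase x.1, x.2⟩) ?_ ?_
    · rintro ⟨v, e⟩ h
      simp only [coe_sigma, Set.mem_sigma_iff, mem_coe, linkIn, mem_filter] at h
      simp only [coe_sigma, Set.mem_sigma_iff, mem_coe, mem_filter, mem_powersetCard]
      exact ⟨⟨h.2.2.2, by rw [card_erase_of_mem h.2.2.1, hE e h.2.1]; rfl⟩, h.2.1,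
        erase_subset _ _⟩
    · rintro ⟨v, e⟩ h ⟨v', e'⟩ h' heq
      simp only [coe_sigma, Set.mem_sigma_iff, mem_coe, linkIn, mem_filter] at h h'
      simp only [Sigma.mk.injEq, heq_eq_eq] at heq
      obtain ⟨h3, rfl⟩ := heq
      have : v = v' := by
        by_contra hne
        exact notMem_erase v e (h3 ▸ mem_erase.2 ⟨hne, h.2.2.1⟩)
      rw [this]
  refine h1.trans ((sum_le_card_nsmul _ _ d fun R hR => hd R (mem_powersetCard.1 hR).2).trans ?_)
  rw [card_powersetCard, smul_eq_mul]
  exact Nat.mul_le_mul_right _ (Nat.choose_le_pow _ _)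

theorem card_filter_superset_le (hE : ∀ e ∈ E, #e = b + 1) (hEV : ∀ e ∈ E, e ⊆ V)
    (hd : ∀ R, #R = b → #{e ∈ E | R ⊆ e} ≤ d) (i : ℕ) (B : Finset α) (hB : #B + i = b) :
    #{e ∈ E | B ⊆ e} ≤ #V ^ i * d := by
  induction i generalizing B with
  | zero => simpa using hd B (by lia)
  | succ i ih =>
    have h1 : {e ∈ E | B ⊆ e} ⊆ (V \ B).biUnion fun x => {e ∈ E | insert x B ⊆ e} := by
      intro e he
      obtain ⟨heE, hBe⟩ := mem_filter.1 he
      obtain ⟨x, hxe, hxB⟩ := exists_mem_notMem_of_card_lt_card (s := B) (t := e)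
        (by rw [hE e heE]; lia)
      refine mem_biUnion.2 ⟨x, mem_sdiff.2 ⟨hEV e heE hxe, hxB⟩, mem_filter.2 ⟨heE, ?_⟩⟩
      exact insert_subset hxe hBe
    refine (card_le_card h1).trans ((card_biUnion_le_card_mul _ _ (#V ^ i * d) ?_).trans ?_)
    · intro x hx
      exact ih _ (by rw [card_insert_of_notMem (mem_sdiff.1 hx).2]; lia)
    · rw [pow_succ, mul_right_comm, mul_comm]
      exact Nat.mul_le_mul_left _ (card_le_card sdiff_subset)

/-- Group the edges by B = f ∩ A. If |B| = b - i, there are at most |V|^i d edges, each of weight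
p^(i+1); as p|V| ≥ 1, the smallest allowed intersection dominates. -/
theorem sum_pow_card_sdiff_le (hE : ∀ e ∈ E, #e = b + 1) (hEV : ∀ e ∈ E, e ⊆ V)
    (hd : ∀ R, #R = b → #{e ∈ E | R ⊆ e} ≤ d) (hp : 0 ≤ p) (hm : 1 ≤ p * #V)
    (A : Finset α) (a : ℕ) :
    ∑ f ∈ E with a ≤ #(f ∩ A) ∧ ¬ f ⊆ A, p ^ #(f \ A) ≤
      2 ^ #A * (p * d * (p * #V) ^ (b - a)) := by
  rw [← sum_fiberwise_of_maps_to (t := A.powerset) (g := fun f => f ∩ A)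
    (fun f _ => mem_powerset.2 inter_subset_right)]
  have h2 : (2 : ℝ) ^ #A = #A.powerset := by simp
  rw [h2, ← nsmul_eq_mul]
  refine sum_le_card_nsmul _ _ _ fun B hB => ?_
  by_cases h : a ≤ #B ∧ #B ≤ b
  · obtain ⟨i, hi⟩ := Nat.exists_eq_add_of_le h.2
    have hcard := card_filter_superset_le hE hEV hd i B hi.symm
    have h3 : ∀ f ∈ {f ∈ {f ∈ E | a ≤ #(f ∩ A) ∧ ¬ f ⊆ A} | f ∩ A = B},
        p ^ #(f \ A) = p ^ (i + 1) := by
      intro f hf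
      simp only [mem_filter] at hf
      have h4 := card_sdiff_add_card_inter f A
      rw [hf.2, hE f hf.1.1] at h4
      congr 1
      lia
    rw [sum_congr rfl h3, sum_const, nsmul_eq_mul]
    have h5 : #{f ∈ {f ∈ E | a ≤ #(f ∩ A) ∧ ¬ f ⊆ A} | f ∩ A = B} ≤ #V ^ i * d := by
      refine le_trans (card_le_card fun f hf => ?_) hcard
      simp only [mem_filter] at hf ⊢
      exact ⟨hf.1.1, hf.2 ▸ inter_subset_left⟩
    calc _ ≤ ((#V ^ i * d : ℕ) : ℝ) * p ^ (i + 1) := by gcongr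
      _ = p * d * (p * #V) ^ i := by push_cast; ring
      _ ≤ _ := by
        gcongr
        lia
  · have h6 : {f ∈ {f ∈ E | a ≤ #(f ∩ A) ∧ ¬ f ⊆ A} | f ∩ A = B} = ∅ := by
      refine filter_eq_empty_iff.2 fun f hf hfB => h ?_
      simp only [mem_filter] at hf
      refine ⟨hfB ▸ hf.2.1, Nat.le_of_lt_add_one ?_⟩
      rw [← hE f hf.1, ← hfB]
      refine card_lt_card (Finset.ssubset_iff_subset_ne.2 ⟨inter_subset_left, fun h => hf.2.2 ?_⟩)
      exact inter_eq_left.1 h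
    rw [h6, sum_empty]
    positivity

/-! ### Local sparsity of a random subset -/

theorem sum_biUnion_le {ι β : Type*} [DecidableEq β] (s : Finset ι) (t : ι → Finset β)
    (w : β → ℝ) (hw : ∀ x, 0 ≤ w x) : ∑ x ∈ s.biUnion t, w x ≤ ∑ i ∈ s, ∑ x ∈ t i, w x := by
  classical
  induction s using Finset.induction_on with
  | empty => simp
  | insert i s hi ih =>
    rw [biUnion_insert, sum_insert hi]
    have := sum_union_inter (s₁ := t i) (s₂ := s.biUnion t) (f := w)
    have h0 : 0 ≤ ∑ x ∈ t i ∩ s.biUnion t, w x := sum_nonneg fun x _ => hw x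
    linarith

/-- The edges that, together with the edges `e₁` and `e₂` through `v`, violate local sparsity. -/
def crossing (E : Finset (Finset α)) (v : α) (e₁ e₂ : Finset α) : Finset (Finset α) :=
  {f ∈ E | v ∉ f ∧ 2 ≤ #(f ∩ (e₁ ∪ e₂)) ∧ ¬ f ⊆ e₁ ∪ e₂}

theorem exists_crossing (hb : 2 ≤ b) (hE : ∀ e ∈ E, #e = b + 1) (hv : v ∉ U)
    (hU : ¬ LocallySparse E U v) :
    ∃ e₁ ∈ linkIn E v U, ∃ e₂ ∈ linkIn E v U, ∃ f ∈ crossing E v e₁ e₂, f ⊆ U := by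
  simp only [LocallySparse, not_forall] at hU
  obtain ⟨f, hf, hfU, x, hx, y, hy, hxN, hyN, hxy⟩ := hU
  obtain ⟨-, e₁, he₁, hxe⟩ := mem_filter.1 hxN
  obtain ⟨-, e₂, he₂, hye⟩ := mem_filter.1 hyN
  have hvf : v ∉ f := fun h => hv (hfU h)
  by_cases hsub : f ⊆ e₁ ∪ e₂
  -- Here f is not crossing for the given pair. As |f| = b + 1 ≥ 3, one of the two edges contains
  -- two vertices of f; that edge is used twice, and it cannot contain f since it has the same size
  -- and contains v ∉ f.
  · have key : ∀ e ∈ linkIn E v U, 2 ≤ #(f ∩ e) → f ∈ crossing E v e e := by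
      intro e he h2
      obtain ⟨heE, hve, -⟩ := mem_filter.1 he
      refine mem_filter.2 ⟨hf, hvf, by rwa [union_self], fun h => ?_⟩
      rw [union_self] at h
      have : #f ≤ #(e.erase v) := card_le_card fun z hz =>
        mem_erase.2 ⟨fun h => hvf (h ▸ hz), h hz⟩
      rw [card_erase_of_mem hve, hE f hf, hE e heE] at this
      lia
    have h3 : #f ≤ #(f ∩ e₁) + #(f ∩ e₂) := by
      refine le_trans (card_le_card ?_) (card_union_le _ _)
      rw [← inter_union_distrib_left]
      exact subset_inter le_rfl hsub
    rw [hE f hf] at h3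
    by_cases h2 : 2 ≤ #(f ∩ e₁)
    · exact ⟨e₁, he₁, e₁, he₁, f, key e₁ he₁ h2, hfU⟩
    · exact ⟨e₂, he₂, e₂, he₂, f, key e₂ he₂ (by lia), hfU⟩
  · refine ⟨e₁, he₁, e₂, he₂, f, mem_filter.2 ⟨hf, hvf, ?_, hsub⟩, hfU⟩
    rw [← card_pair hxy]
    refine card_le_card ?_
    intro z hz
    simp only [mem_insert, mem_singleton] at hz
    rcases hz with rfl | rfl <;> simp [*]

theorem card_erase_union_union {e₁ e₂ f : Finset α} (h₁ : v ∈ e₁) (hf : v ∉ f) :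
    #((e₁ ∪ e₂ ∪ f).erase v) = #(e₁ \ {v}) + #(e₂ \ e₁) + #(f \ (e₁ ∪ e₂)) := by
  have h : (e₁ ∪ e₂ ∪ f).erase v = (e₁ \ {v} ∪ e₂ \ e₁) ∪ f \ (e₁ ∪ e₂) := by
    ext x; grind
  rw [h, card_union_of_disjoint, card_union_of_disjoint]
  · exact disjoint_of_subset_left sdiff_subset disjoint_sdiff
  · refine disjoint_of_subset_left ?_ disjoint_sdiff
    exact union_subset_union sdiff_subset sdiff_subset

open Classical in
theorem sum_weight_not_locallySparse_le (hb : 2 ≤ b) (hE : ∀ e ∈ E, #e = b + 1)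
    (hEV : ∀ e ∈ E, e ⊆ V) (hp : 0 ≤ p) (hp1 : p ≤ 1) :
    ∑ U ∈ V.powerset with v ∉ U ∧ ¬ LocallySparse E U v, weight V p U ≤
      ∑ e₁ ∈ E with v ∈ e₁, p ^ #(e₁ \ {v}) * ∑ e₂ ∈ E with v ∈ e₂, p ^ #(e₂ \ e₁) *
        ∑ f ∈ crossing E v e₁ e₂, p ^ #(f \ (e₁ ∪ e₂)) := by
  have hw : ∀ U, 0 ≤ weight V p U := fun U => weight_nonneg hp hp1
  calc _ ≤ ∑ U ∈ {e ∈ E | v ∈ e}.biUnion fun e₁ => {e ∈ E | v ∈ e}.biUnion fun e₂ =>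
        (crossing E v e₁ e₂).biUnion fun f => {U ∈ V.powerset | (e₁ ∪ e₂ ∪ f).erase v ⊆ U},
        weight V p U := by
        refine sum_le_sum_of_subset_of_nonneg (fun U hU => ?_) fun U _ _ => hw U
        obtain ⟨hUV, hvU, hns⟩ := mem_filter.1 hU
        obtain ⟨e₁, he₁, e₂, he₂, f, hf, hfU⟩ := exists_crossing hb hE hvU hns
        obtain ⟨h1E, hv1, h1⟩ := mem_filter.1 he₁
        obtain ⟨h2E, hv2, h2⟩ := mem_filter.1 he₂
        simp only [mem_biUnion, mem_filter]
        refine ⟨e₁, ⟨h1E, hv1⟩, e₂, ⟨h2E, hv2⟩, f, hf, hUV, ?_⟩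
        rw [erase_union_distrib, erase_union_distrib]
        exact union_subset (union_subset h1 h2) ((erase_subset _ _).trans hfU)
    _ ≤ ∑ e₁ ∈ E with v ∈ e₁, ∑ e₂ ∈ E with v ∈ e₂, ∑ f ∈ crossing E v e₁ e₂,
        ∑ U ∈ V.powerset with (e₁ ∪ e₂ ∪ f).erase v ⊆ U, weight V p U := by
        refine (sum_biUnion_le _ _ _ hw).trans (sum_le_sum fun e₁ _ => ?_)
        refine (sum_biUnion_le _ _ _ hw).trans (sum_le_sum fun e₂ _ => ?_)
        exact sum_biUnion_le _ _ _ hw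
    _ = _ := by
        refine sum_congr rfl fun e₁ he₁ => ?_
        rw [mul_sum]
        refine sum_congr rfl fun e₂ he₂ => ?_
        rw [mul_sum, mul_sum]
        refine sum_congr rfl fun f hf => ?_
        obtain ⟨h1E, hv1⟩ := mem_filter.1 he₁
        obtain ⟨h2E, hv2⟩ := mem_filter.1 he₂
        obtain ⟨hfE, hvf, -⟩ := mem_filter.1 hf
        rw [sum_weight_superset, card_erase_union_union hv1 hvf, pow_add, pow_add, mul_assoc]
        exact (erase_subset _ _).trans
          (union_subset (union_subset (hEV _ h1E) (hEV _ h2E)) (hEV _ hfE))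

-- First moment: choosing e₁, then e₂ sharing at least v with it, then f sharing two vertices with
-- their union costs O(D), O(D) and O(D / (p|V|)), so the total is O(D³ / (p|V|)).
open Classical in
theorem sum_weight_not_locallySparse_le_half (hb : 2 ≤ b) (hE : ∀ e ∈ E, #e = b + 1)
    (hEV : ∀ e ∈ E, e ⊆ V) (hd : ∀ R, #R = b → #{e ∈ E | R ⊆ e} ≤ d) (hp : 0 ≤ p) (hp1 : p ≤ 1)
    (hm : 1 ≤ p * #V) {D : ℝ} (hD1 : 1 ≤ D) (hD : p * d * (p * #V) ^ (b - 1) ≤ D)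
    (hDm : 2 ^ (3 * b + 6) * D ^ 3 ≤ p * #V) :
    ∑ U ∈ V.powerset with v ∉ U ∧ ¬ LocallySparse E U v, weight V p U ≤ 1 / 2 := by
  set m : ℝ := p * #V with hm_def
  have hm0 : 0 < m := by linarith
  have hf : ∀ e₁ ∈ {e ∈ E | v ∈ e}, ∀ e₂ ∈ {e ∈ E | v ∈ e},
      ∑ f ∈ crossing E v e₁ e₂, p ^ #(f \ (e₁ ∪ e₂)) ≤ 2 ^ (2 * b + 2) * (D / m) := by
    intro e₁ he₁ e₂ he₂
    have h1 : ∑ f ∈ crossing E v e₁ e₂, p ^ #(f \ (e₁ ∪ e₂)) ≤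
        ∑ f ∈ E with 2 ≤ #(f ∩ (e₁ ∪ e₂)) ∧ ¬ f ⊆ e₁ ∪ e₂, p ^ #(f \ (e₁ ∪ e₂)) := by
      refine sum_le_sum_of_subset_of_nonneg (fun f hf => ?_) fun f _ _ => pow_nonneg hp _
      obtain ⟨h1, -, h2⟩ := mem_filter.1 hf
      exact mem_filter.2 ⟨h1, h2⟩
    refine h1.trans ((sum_pow_card_sdiff_le hE hEV hd hp hm _ 2).trans ?_)
    have h2 : #(e₁ ∪ e₂) ≤ 2 * b + 2 := by
      refine (card_union_le _ _).trans ?_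
      rw [hE e₁ (mem_filter.1 he₁).1, hE e₂ (mem_filter.1 he₂).1]
      lia
    gcongr
    · norm_num
    · rw [le_div_iff₀ hm0]
      refine le_trans (le_of_eq ?_) hD
      rw [mul_assoc, ← pow_succ]
      congr 2
      lia
  have he2 : ∀ e₁ ∈ {e ∈ E | v ∈ e}, ∑ e₂ ∈ E with v ∈ e₂, p ^ #(e₂ \ e₁) ≤ 2 ^ (b + 2) * D := by
    intro e₁ he₁
    obtain ⟨h1E, hv1⟩ := mem_filter.1 he₁
    -- The choice e₂ = e₁ contributes 1, which is absorbed using D ≥ 1.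
    have h1 : {e ∈ E | v ∈ e} ⊆ insert e₁ {e ∈ E | 1 ≤ #(e ∩ e₁) ∧ ¬ e ⊆ e₁} := by
      intro e he
      obtain ⟨hE', hve⟩ := mem_filter.1 he
      by_cases hee : e ⊆ e₁
      · rw [eq_of_subset_of_card_le hee (by rw [hE e hE', hE e₁ h1E])]
        exact mem_insert_self _ _
      · refine mem_insert_of_mem (mem_filter.2 ⟨hE', card_pos.2 ⟨v, ?_⟩, hee⟩)
        exact mem_inter.2 ⟨hve, hv1⟩
    have h2 := sum_pow_card_sdiff_le hE hEV hd hp hm e₁ 1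
    rw [hE e₁ h1E] at h2
    calc _ ≤ ∑ e ∈ insert e₁ {e ∈ E | 1 ≤ #(e ∩ e₁) ∧ ¬ e ⊆ e₁}, p ^ #(e \ e₁) :=
          sum_le_sum_of_subset_of_nonneg h1 fun f _ _ => pow_nonneg hp _
      _ = 1 + ∑ e ∈ E with 1 ≤ #(e ∩ e₁) ∧ ¬ e ⊆ e₁, p ^ #(e \ e₁) := by
          rw [sum_insert (by simp)]; simp
      _ ≤ 1 + 2 ^ (b + 1) * D := by
          gcongr
          exact h2.trans (by gcongr)
      _ ≤ 2 ^ (b + 2) * D := by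
          have : (1 : ℝ) ≤ 2 ^ (b + 1) := one_le_pow₀ (by norm_num)
          rw [pow_succ _ (b + 1)]
          nlinarith
  have he1 : ∑ e₁ ∈ E with v ∈ e₁, p ^ #(e₁ \ {v}) ≤ 2 * D := by
    have h2 := sum_pow_card_sdiff_le hE hEV hd hp hm {v} 1
    rw [card_singleton, pow_one] at h2
    refine le_trans (sum_le_sum_of_subset_of_nonneg (fun e he => ?_)
      fun f _ _ => pow_nonneg hp _) (h2.trans (by gcongr))
    obtain ⟨hE', hve⟩ := mem_filter.1 he
    refine mem_filter.2 ⟨hE', card_pos.2 ⟨v, by simp [hve]⟩, fun h => ?_⟩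
    have := card_le_card h
    rw [hE e hE', card_singleton] at this
    lia
  have hDm0 : 0 ≤ D / m := by positivity
  calc _ ≤ _ := sum_weight_not_locallySparse_le hb hE hEV hp hp1
    _ ≤ ∑ e₁ ∈ E with v ∈ e₁, p ^ #(e₁ \ {v}) * ∑ e₂ ∈ E with v ∈ e₂, p ^ #(e₂ \ e₁) *
        (2 ^ (2 * b + 2) * (D / m)) := by
        gcongr with e₁ he₁ e₂ he₂
        exact hf e₁ he₁ e₂ he₂
    _ ≤ ∑ e₁ ∈ E with v ∈ e₁, p ^ #(e₁ \ {v}) *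
        ((2 ^ (b + 2) * D) * (2 ^ (2 * b + 2) * (D / m))) := by
        gcongr with e₁ he₁
        rw [← sum_mul]
        gcongr
        exact he2 e₁ he₁
    _ ≤ (2 * D) * ((2 ^ (b + 2) * D) * (2 ^ (2 * b + 2) * (D / m))) := by
        rw [← sum_mul]
        gcongr
    _ = (2 ^ (3 * b + 6) * D ^ 3) / m / 2 := by
        rw [show 3 * b + 6 = (b + 2) + (2 * b + 2) + 2 by ring, pow_add _ _ 2, pow_add]
        field_simp
        ring
    _ ≤ 1 / 2 := by
        have : (2 ^ (3 * b + 6) * D ^ 3) / m ≤ 1 := (div_le_one hm0).2 hDm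
        linarith

end FinsetFamily

namespace FinsetFamily
open Finset
variable {α : Type*} [DecidableEq α] {E : Finset (Finset α)} {U V W : Finset α} {v : α} {p : ℝ}
  {b d a : ℕ}

/-! ### The global inequality -/

theorem linkConst_pos (hb : 1 ≤ b) : 0 < linkConst b := by
  have h1 : ((1 : ℝ) / 2) ^ b < 1 := pow_lt_one₀ (by norm_num) (by norm_num) (by lia)
  have h2 : (0 : ℝ) < (1 / 2) ^ b := by positivity
  have h3 : Real.log (1 - (1 / 2) ^ b) < 0 := Real.log_neg (by linarith) (by linarith)
  have h4 : (0 : ℝ) < 2 ^ b := by positivity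
  unfold linkConst
  nlinarith

open Classical in
theorem quarter_le_sum_weight_locallySparse (hv : v ∈ V) (hp4 : p ≤ 1 / 4)
    (h : ∑ U ∈ V.powerset with v ∉ U ∧ ¬ LocallySparse E U v, weight V p U ≤ 1 / 2) :
    1 / 4 ≤ ∑ U ∈ V.powerset with v ∉ U ∧ LocallySparse E U v, weight V p U := by
  have h1 := sum_weight_superset (p := p) (singleton_subset_iff.2 hv)
  simp only [singleton_subset_iff, card_singleton, pow_one] at h1
  have h2 := sum_filter_add_sum_filter_not V.powerset (fun U => v ∈ U) (weight V p)
  have h3 := sum_filter_add_sum_filter_not {U ∈ V.powerset | v ∉ U}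
    (fun U => LocallySparse E U v) (weight V p)
  rw [filter_filter, filter_filter] at h3
  rw [sum_weight] at h2
  linarith

theorem sum_average_linkIn_le (hE : ∀ e ∈ E, #e = b + 1)
    (hd : ∀ R, #R = b → #{e ∈ E | R ⊆ e} ≤ d) (ha : ∀ W ∈ indepSets E V, #W ≤ a) (hU : U ⊆ V)
    (A : Finset α) :
    ∑ v ∈ A, (∑ W ∈ indepSets E U, (#(linkIn E v W) : ℝ)) / #(indepSets E U) ≤ a ^ b * d := by
  have hpos : (0 : ℝ) < #(indepSets E U) := by
    exact_mod_cast card_indepSets_pos fun e he => card_pos.1 (by rw [hE e he]; lia)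
  rw [← sum_div, sum_comm, div_le_iff₀ hpos, mul_comm, ← nsmul_eq_mul]
  refine sum_le_card_nsmul _ _ _ fun W hW => ?_
  obtain ⟨h1, h2⟩ := mem_indepSets.1 hW
  have h3 := ha W (mem_indepSets.2 ⟨h1.trans hU, h2⟩)
  have h4 := (sum_card_linkIn_le hE hd A W).trans (Nat.mul_le_mul_right d (Nat.pow_le_pow_left h3 b))
  exact_mod_cast h4

open Classical in
theorem global_inequality (hb : 1 ≤ b) (hE : ∀ e ∈ E, #e = b + 1)
    (hd : ∀ R, #R = b → #{e ∈ E | R ⊆ e} ≤ d) (ha : ∀ W ∈ indepSets E V, #W ≤ a)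
    (hp : 0 < p) (hp4 : p ≤ 1 / 4)
    (hs : ∀ v ∈ V, ∑ U ∈ V.powerset with v ∉ U ∧ ¬ LocallySparse E U v, weight V p U ≤ 1 / 2)
    {L : ℝ} (hL : 0 ≤ L) :
    #V / 4 * (1 + L) - linkConst b * (a ^ b * d) ≤ Real.exp L * (2 * a / p) := by
  have hp1 : p ≤ 1 := by linarith
  have hne : ∀ e ∈ E, e.Nonempty := fun e he => card_pos.1 (by rw [hE e he]; lia)
  have hpos : ∀ U : Finset α, (0 : ℝ) < #(indepSets E U) := fun U => by
    exact_mod_cast card_indepSets_pos hne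
  have hκ := linkConst_pos hb
  have hw : ∀ U, 0 ≤ weight V p U := fun U => weight_nonneg hp.le hp1
  set G : Finset α → Finset α := fun U => {v ∈ V \ U | LocallySparse E U v} with hG
  set Φ : Finset α → α → ℝ := fun U v =>
    (∑ W ∈ indepSets E U, (#(linkIn E v W) : ℝ)) / #(indepSets E U) with hΦ
  have hmass : #V / 4 ≤ ∑ U ∈ V.powerset, weight V p U * #(G U) := by
    calc (#V : ℝ) / 4 = ∑ v ∈ V, (1 / 4 : ℝ) := by rw [sum_const, nsmul_eq_mul]; ring
      _ ≤ ∑ v ∈ V, ∑ U ∈ V.powerset with v ∉ U ∧ LocallySparse E U v, weight V p U :=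
        sum_le_sum fun v hv => quarter_le_sum_weight_locallySparse hv hp4 (hs v hv)
      _ = ∑ U ∈ V.powerset, ∑ v ∈ V,
          if v ∉ U ∧ LocallySparse E U v then weight V p U else 0 := by
        simp only [sum_filter]
        exact sum_comm
      _ = _ := by
        refine sum_congr rfl fun U _ => ?_
        rw [← sum_filter, sum_const, nsmul_eq_mul, mul_comm]
        congr 3
        ext v
        simp only [hG, mem_filter, mem_sdiff]
        tauto
  have hΦsum : ∑ U ∈ V.powerset, weight V p U * ∑ v ∈ G U, Φ U v ≤ a ^ b * d := by
    calc _ ≤ ∑ U ∈ V.powerset, weight V p U * (a ^ b * d : ℝ) := by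
          refine sum_le_sum fun U hU => mul_le_mul_of_nonneg_left ?_ (hw U)
          exact sum_average_linkIn_le hE hd ha (mem_powerset.1 hU) _
      _ = _ := by rw [← sum_mul, sum_weight, one_mul]
  have hloc : ∑ U ∈ V.powerset, weight V p U *
      ∑ v ∈ G U, Real.exp (-L) * ((1 + L) - linkConst b * Φ U v) ≤ 2 * a / p := by
    rw [le_div_iff₀ hp, mul_comm]
    refine le_trans ?_ (sum_weight_extendable_le hne hp.le hp1 ha)
    refine mul_le_mul_of_nonneg_left (sum_le_sum fun U _ => ?_) hp.le
    refine mul_le_mul_of_nonneg_left ?_ (hw U)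
    refine le_trans (sum_le_sum fun v hv => ?_)
      (sum_le_sum_of_subset_of_nonneg (filter_subset _ _) fun v _ _ => by positivity)
    rw [le_div_iff₀ (hpos U)]
    refine le_trans (le_of_eq ?_) (le_card_extendable hb hE (mem_filter.1 hv).2 L)
    have := (hpos U).ne'
    simp only [hΦ]
    field_simp
  have hsplit : ∑ U ∈ V.powerset, weight V p U *
      ∑ v ∈ G U, Real.exp (-L) * ((1 + L) - linkConst b * Φ U v) =
      Real.exp (-L) * ((1 + L) * ∑ U ∈ V.powerset, weight V p U * #(G U) -
        linkConst b * ∑ U ∈ V.powerset, weight V p U * ∑ v ∈ G U, Φ U v) := by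
    simp only [mul_sub, mul_sum, sum_sub_distrib, sum_const, nsmul_eq_mul]
    congr 1
    · exact sum_congr rfl fun U _ => by ring
    · exact sum_congr rfl fun U _ => sum_congr rfl fun v _ => by ring
  rw [hsplit] at hloc
  have hexp : Real.exp L * Real.exp (-L) = 1 := by rw [← Real.exp_add]; simp
  have h1 := mul_le_mul_of_nonneg_left hloc (Real.exp_pos L).le
  rw [← mul_assoc, hexp, one_mul] at h1
  have h2 := mul_le_mul_of_nonneg_left hmass (by linarith : 0 ≤ 1 + L)
  have h3 := mul_le_mul_of_nonneg_left hΦsum hκ.le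
  linarith

open Classical in
theorem card_mul_log_le (hb : 1 ≤ b) (hE : ∀ e ∈ E, #e = b + 1) (hEV : ∀ e ∈ E, e ⊆ V)
    (hd : ∀ R, #R = b → #{e ∈ E | R ⊆ e} ≤ a) (ha : ∀ W ∈ indepSets E V, #W ≤ a)
    (hsp : b = 1 → ∀ U v, v ∉ U → LocallySparse E U v) (ha0 : 1 ≤ a)
    (hp : 0 < p) (hp4 : p ≤ 1 / 4) {D : ℝ} (hD1 : 1 ≤ D)
    (hD : p * a * (p * #V) ^ (b - 1) ≤ D) (hDm : 2 ^ (3 * b + 6) * D ^ 3 ≤ p * #V)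
    (ham : 8 * a ≤ p * #V) :
    #V / 4 * Real.log (p * #V / (8 * a)) ≤ linkConst b * a ^ (b + 1) := by
  have ha0' : (1 : ℝ) ≤ a := by exact_mod_cast ha0
  have hs : ∀ v ∈ V,
      ∑ U ∈ V.powerset with v ∉ U ∧ ¬ LocallySparse E U v, weight V p U ≤ 1 / 2 := by
    intro v _
    rcases hb.eq_or_lt with h | h
    · rw [sum_eq_zero]
      · norm_num
      · intro U hU
        exact absurd (hsp h.symm U v (mem_filter.1 hU).2.1) (mem_filter.1 hU).2.2
    · exact sum_weight_not_locallySparse_le_half h hE hEV hd hp.le (by linarith) (by linarith)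
        hD1 hD hDm
  have hx : 1 ≤ p * #V / (8 * a) := by rw [le_div_iff₀ (by positivity)]; linarith
  -- With L = log(p|V| / (8a)) the right side becomes |V|/4 and cancels the 1 in 1 + L.
  have h := global_inequality hb hE hd ha hp hp4 hs (Real.log_nonneg hx)
  rw [Real.exp_log (by linarith)] at h
  have h2 : p * #V / (8 * a) * (2 * a / p) = #V / 4 := by
    field_simp
    ring
  rw [h2] at h
  rw [pow_succ]
  linarith

/-! ### Choice of parameters -/

open Filter Real in
theorem eventually_log_bounds (k : ℕ) (hk : 1 ≤ k) (C δ : ℝ) (hδ : 0 < δ) :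
    ∀ᶠ x : ℝ in atTop, 1 ≤ x ∧ 1 ≤ log x ∧ C * log x ^ 3 ≤ x ^ (1 / (2 * k : ℝ)) ∧
      4 * log x ≤ x ^ (1 / 4 : ℝ) ∧ 8 ≤ x ^ (δ / 2) := by
  have hk' : (0 : ℝ) < 1 / (2 * k : ℝ) := by positivity
  have h1 := (isLittleO_log_rpow_rpow_atTop 3 hk').bound (c := 1 / (|C| + 1)) (by positivity)
  have h2 := (isLittleO_log_rpow_atTop (r := 1 / 4) (by norm_num)).bound (c := 1 / 4) (by norm_num)
  have h3 := (tendsto_rpow_atTop (half_pos hδ)).eventually_ge_atTop 8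
  have h4 := tendsto_log_atTop.eventually_ge_atTop 1
  filter_upwards [h1, h2, h3, h4, eventually_ge_atTop 1] with x h1 h2 h3 h4 h5
  have hx : 0 ≤ x := by linarith
  have hl : 0 ≤ log x := by linarith
  rw [norm_of_nonneg (by positivity), norm_of_nonneg (by positivity)] at h1 h2
  rw [show (3 : ℝ) = (3 : ℕ) by norm_num, rpow_natCast] at h1
  refine ⟨h5, h4, ?_, by linarith, h3⟩
  rw [one_div_mul_eq_div, le_div_iff₀ (by positivity)] at h1
  have h6 : C ≤ |C| + 1 := by linarith [le_abs_self C]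
  have h7 : 0 ≤ log x ^ 3 := by positivity
  nlinarith

open Filter Real in
theorem exists_parameters (b : ℕ) (hb : 1 ≤ b) : ∃ δ : ℝ, 0 < δ ∧ ∀ᶠ x : ℝ in atTop,
    0 < log x ∧ ∀ a : ℝ, 1 ≤ a → a ≤ (x * log x) ^ ((1 : ℝ) / (b + 1 : ℕ)) → ∃ p D : ℝ,
      0 < p ∧ p ≤ 1 / 4 ∧ 1 ≤ D ∧ p * a * (p * x) ^ (b - 1) ≤ D ∧
      2 ^ (3 * b + 6) * D ^ 3 ≤ p * x ∧ 8 * a ≤ p * x ∧ δ * log x ≤ log (p * x / (8 * a)) := by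
  set k : ℕ := b + 1 with hk
  have hk2 : (2 : ℝ) ≤ k := by exact_mod_cast (by lia : 2 ≤ k)
  -- Chosen so that x^(3bδ) ≤ x^(1/(2k)): the power of x in D³ then uses half of the exponent 1/k
  -- available in p x, and the other half absorbs the logarithms and constants.
  set δ : ℝ := 1 / (6 * k ^ 2) with hδdef
  have hδ : 0 < δ := by positivity
  refine ⟨δ / 2, half_pos hδ, ?_⟩
  filter_upwards [eventually_log_bounds k (by lia) (2 ^ (3 * b + 6)) δ hδ]
    with x ⟨hx1, hl1, hE1, hE2, hE3⟩
  have hx0 : 0 < x := by linarith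
  have hl0 : 0 < log x := by linarith
  refine ⟨hl0, fun a ha1 haw => ?_⟩
  set w := (x * log x) ^ ((1 : ℝ) / k) with hw
  have hw0 : 0 < w := by positivity
  have hwk : w ^ k = x * log x := by
    rw [hw, ← rpow_natCast, ← rpow_mul (by positivity), one_div_mul_cancel (by positivity),
      rpow_one]
  have hxδ : 1 ≤ x ^ δ := one_le_rpow hx1 hδ.le
  set m := w * x ^ δ with hm
  have hm0 : 0 < m := by positivity
  have hpx : m / x * x = m := by field_simp
  have hδk : δ * (6 * k ^ 2) = 1 := by rw [hδdef]; field_simp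
  have hwlow : x ^ ((1 : ℝ) / k) ≤ w := by
    rw [hw]
    gcongr
    nlinarith
  have h8 : x ^ δ = x ^ (δ / 2) * x ^ (δ / 2) := by rw [← rpow_add hx0]; ring_nf
  have ham : a * x ^ δ ≤ m := by rw [hm]; gcongr
  -- D is dictated by a m^b / x ≤ w^k x^(δb) / x = x^(δb) log x. In the last goal half of the factor
  -- x^δ pays for the 8, hence δ/2.
  refine ⟨m / x, (x ^ δ) ^ b * log x, by positivity, ?_, ?_, ?_, ?_, ?_, ?_⟩
  · have h1 : w ≤ x ^ ((1 : ℝ) / k) * log x := by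
      rw [hw, mul_rpow hx0.le hl0.le]
      gcongr
      calc log x ^ ((1 : ℝ) / k) ≤ log x ^ (1 : ℝ) := by
            refine rpow_le_rpow_of_exponent_le hl1 ?_
            rw [div_le_one (by positivity)]; linarith
        _ = log x := rpow_one _
    have h2 : x ^ ((1 : ℝ) / k) * x ^ δ ≤ x ^ (3 / 4 : ℝ) := by
      rw [← rpow_add hx0]
      refine rpow_le_rpow_of_exponent_le hx1 ?_
      have h3 : (1 : ℝ) / k ≤ 1 / 2 := one_div_le_one_div_of_le (by norm_num) hk2
      have h4 : δ ≤ 1 / 4 := by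
        rw [hδdef]
        exact one_div_le_one_div_of_le (by norm_num) (by nlinarith)
      linarith
    have h3 : x ^ (3 / 4 : ℝ) * x ^ (1 / 4 : ℝ) = x := by
      rw [← rpow_add hx0]; norm_num
    rw [div_le_iff₀ hx0]
    calc m ≤ (x ^ ((1 : ℝ) / k) * log x) * x ^ δ := by rw [hm]; gcongr
      _ = (x ^ ((1 : ℝ) / k) * x ^ δ) * log x := by ring
      _ ≤ x ^ (3 / 4 : ℝ) * (x ^ (1 / 4 : ℝ) / 4) := by
          gcongr
          linarith
      _ = 1 / 4 * x := by rw [← mul_div_assoc, h3]; ring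
  · exact one_le_mul_of_one_le_of_one_le (one_le_pow₀ hxδ) hl1
  · rw [hpx]
    have h1 : m / x * a * m ^ (b - 1) = a * m ^ b / x := by
      obtain ⟨c, rfl⟩ := Nat.exists_eq_add_of_le' hb
      rw [Nat.add_sub_cancel, pow_succ]
      ring
    rw [h1, div_le_iff₀ hx0]
    calc a * m ^ b ≤ w * m ^ b := by gcongr
      _ = w ^ k * (x ^ δ) ^ b := by rw [hm, hk]; ring
      _ = _ := by rw [hwk]; ring
  · rw [hpx]
    have h1 : ((x ^ δ) ^ b) ^ 3 ≤ x ^ (1 / (2 * k : ℝ)) := by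
      rw [← pow_mul, ← rpow_natCast, ← rpow_mul hx0.le]
      refine rpow_le_rpow_of_exponent_le hx1 ?_
      rw [le_div_iff₀ (by positivity)]
      have : (b : ℝ) ≤ k := by exact_mod_cast (by lia : b ≤ k)
      push_cast
      calc δ * (b * 3) * (2 * k) ≤ δ * (k * 3) * (2 * k) := by gcongr
        _ = 1 := by rw [← hδk]; ring
    have h2 : x ^ (1 / (2 * k : ℝ)) * x ^ (1 / (2 * k : ℝ)) = x ^ ((1 : ℝ) / k) := by
      rw [← rpow_add hx0]
      congr 1
      field_simp
      norm_num
    calc _ = ((x ^ δ) ^ b) ^ 3 * (2 ^ (3 * b + 6) * log x ^ 3) := by ring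
      _ ≤ x ^ (1 / (2 * k : ℝ)) * x ^ (1 / (2 * k : ℝ)) := by gcongr
      _ ≤ w * 1 := by rw [h2, mul_one]; exact hwlow
      _ ≤ m := by rw [hm]; gcongr
  · rw [hpx, mul_comm]
    refine le_trans (mul_le_mul_of_nonneg_left ?_ (by linarith)) ham
    rw [h8]
    nlinarith
  · rw [hpx]
    have h1 : x ^ (δ / 2) ≤ m / (8 * a) := by
      rw [le_div_iff₀ (by positivity)]
      refine le_trans ?_ ham
      calc x ^ (δ / 2) * (8 * a) = a * (x ^ (δ / 2) * 8) := by ring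
        _ ≤ a * (x ^ (δ / 2) * x ^ (δ / 2)) := by gcongr
        _ = a * x ^ δ := by rw [h8]
    rw [← log_rpow hx0]
    exact log_le_log (by positivity) h1

open Filter Real in
-- The same a bounds codegrees and independent sets. If a exceeds (n log n)^(1/r) there is nothing
-- to prove; small n is handled by a ≥ 1 and the factor 1/M.
theorem exists_const_le_of_codegree_le (b : ℕ) (hb : 1 ≤ b) : ∃ c : ℝ, 0 < c ∧
    ∀ {α : Type*} [DecidableEq α] (E : Finset (Finset α)) (V : Finset α) (a : ℕ),
      (∀ e ∈ E, #e = b + 1) → (∀ e ∈ E, e ⊆ V) → (∀ R, #R = b → #{e ∈ E | R ⊆ e} ≤ a) →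
      (∀ W ∈ indepSets E V, #W ≤ a) → (b = 1 → ∀ U v, v ∉ U → LocallySparse E U v) →
      c * ((#V : ℝ) * log #V) ^ ((1 : ℝ) / (b + 1 : ℕ)) ≤ a := by
  obtain ⟨δ, hδ, hev⟩ := exists_parameters b hb
  obtain ⟨x₀, hx₀⟩ := eventually_atTop.1 hev
  have hκ := linkConst_pos hb
  set s : ℝ := (1 : ℝ) / (b + 1 : ℕ) with hs
  have hs0 : 0 < s := by positivity
  set M : ℝ := (|x₀| * |x₀|) ^ s + 1 with hM
  have hM0 : 0 < M := by positivity
  set c₁ : ℝ := (δ / (4 * linkConst b)) ^ s with hc₁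
  have hc₁0 : 0 < c₁ := by positivity
  refine ⟨min (min 1 c₁) (1 / M), by positivity, ?_⟩
  intro α _ E V a hE hEV hd ha hsp
  have hlog : 0 ≤ log (#V : ℝ) := log_natCast_nonneg _
  have hw0 : (0 : ℝ) ≤ ((#V : ℝ) * log #V) ^ s := by positivity
  rcases V.eq_empty_or_nonempty with rfl | ⟨v, hv⟩
  · simp [zero_rpow hs0.ne']
  have ha1 : 1 ≤ a := by
    have := ha {v} (mem_indepSets.2 ⟨singleton_subset_iff.2 hv, fun e he h => ?_⟩)
    · simpa using this
    · have h2 := card_le_card h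
      rw [hE e he, card_singleton] at h2
      lia
  have ha1' : (1 : ℝ) ≤ a := by exact_mod_cast ha1
  by_cases hn : x₀ ≤ #V
  · by_cases haw : (a : ℝ) ≤ ((#V : ℝ) * log #V) ^ s
    · obtain ⟨hl0, hpar⟩ := hx₀ _ hn
      obtain ⟨p, D, hp, hp4, hD1, hD, hDm, ham, hδl⟩ := hpar a ha1' haw
      have hmain := card_mul_log_le hb hE hEV hd ha hsp ha1 hp hp4 hD1 hD hDm ham
      have h1 : (#V : ℝ) / 4 * (δ * log #V) ≤ linkConst b * a ^ (b + 1) :=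
        le_trans (by gcongr) hmain
      have h2 : δ / (4 * linkConst b) * ((#V : ℝ) * log #V) ≤ (a : ℝ) ^ (b + 1) := by
        rw [div_mul_eq_mul_div, div_le_iff₀ (by positivity)]
        linarith
      calc _ ≤ c₁ * ((#V : ℝ) * log #V) ^ s := by
            gcongr
            exact (min_le_left _ _).trans (min_le_right _ _)
        _ = (δ / (4 * linkConst b) * ((#V : ℝ) * log #V)) ^ s := by
            exact (mul_rpow (by positivity) (by positivity)).symm
        _ ≤ ((a : ℝ) ^ (b + 1)) ^ s := by gcongr
        _ = a := by
            rw [← rpow_natCast, ← rpow_mul (by positivity), hs, mul_one_div_cancel (by positivity),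
              rpow_one]
    · calc _ ≤ 1 * ((#V : ℝ) * log #V) ^ s := by
            gcongr
            exact (min_le_left _ _).trans (min_le_left _ _)
        _ ≤ a := by rw [one_mul]; exact (not_le.1 haw).le
  · have h1 : (#V : ℝ) ≤ |x₀| := (not_le.1 hn).le.trans (le_abs_self _)
    have h2 : log #V ≤ |x₀| := (log_le_self (by positivity)).trans h1
    calc _ ≤ 1 / M * M := by
          gcongr
          · exact min_le_right _ _
          · rw [hM]
            have : ((#V : ℝ) * log #V) ^ s ≤ (|x₀| * |x₀|) ^ s := by gcongr
            linarith
      _ = 1 := one_div_mul_cancel hM0.ne'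
      _ ≤ a := ha1'

end FinsetFamily

namespace Hypergraph

/-! ### Edges through an (r-1)-set, and the independence number as an attained maximum -/

variable {α β : Type*} {H : Hypergraph α} {r : ℕ}

theorem nbhd_subset_vertexSet (H : Hypergraph α) (R : Set α) : H.nbhd R ⊆ V(H) := by
  rintro v ⟨e, he, -, hv⟩
  exact he.subset_vertexSet hv.1

theorem eq_insert_of_mem_sdiff (hr : 1 ≤ r) {R e : Set α} {x : α} (he : e.ncard = r)
    (hR : R.ncard = r - 1) (hRe : R ⊆ e) (hx : x ∈ e \ R) : e = insert x R := by
  -- `ncard` is 0 on infinite sets, so finiteness comes from r ≥ 1. For r = 1 the size of R gives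
  -- nothing, hence R is handled through R ⊆ e.
  have hef : e.Finite := Set.finite_of_ncard_pos (by lia)
  have hRf : R.Finite := hef.subset hRe
  refine (Set.eq_of_subset_of_ncard_le (Set.insert_subset hx.1 hRe) ?_ hef).symm
  rw [Set.ncard_insert_of_notMem hx.2 hRf]
  lia

theorem insert_mem_edgeSet_of_mem_nbhd (hr : 1 ≤ r) (hH : H.IsRGraph r) {R : Set α} {x : α}
    (hR : R.ncard = r - 1) (hx : x ∈ H.nbhd R) : x ∉ R ∧ insert x R ∈ E(H) := by
  obtain ⟨e, he, hRe, hxe⟩ := hx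
  refine ⟨hxe.2, ?_⟩
  rwa [← eq_insert_of_mem_sdiff hr (hH.2 e he) hR hRe hxe]

theorem IsIndepSet.ncard_le_indepNum (hV : V(H).Finite) {Z : Set α} (hZ : H.IsIndepSet Z) :
    Z.ncard ≤ H.indepNum := by
  refine le_csSup ⟨V(H).ncard, ?_⟩ ⟨Z, hZ, rfl⟩
  rintro k ⟨Z', hZ', rfl⟩
  exact Set.ncard_le_ncard hZ'.1 hV

theorem exists_isIndepSet_ncard_eq_indepNum (hV : V(H).Finite) (hE : ∀ e ∈ E(H), e.Nonempty) :
    ∃ Z, H.IsIndepSet Z ∧ Z.ncard = H.indepNum := by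
  refine Nat.sSup_mem (s := {k : ℕ | ∃ Z : Set α, H.IsIndepSet Z ∧ Z.ncard = k})
    ⟨0, ∅, ⟨Set.empty_subset _, fun e he h => ?_⟩, Set.ncard_empty α⟩ ⟨V(H).ncard, ?_⟩
  · exact (hE e he).ne_empty (Set.subset_empty_iff.1 h)
  · rintro k ⟨Z', hZ', rfl⟩
    exact Set.ncard_le_ncard hZ'.1 hV

/-! ### Independent neighborhoods and copies of `T r` -/

theorem Contains.not_hasIndepNbhds (hr : 1 ≤ r) (h : H.Contains (T r)) : ¬ H.HasIndepNbhds r := by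
  obtain ⟨f, hf, hV, hE⟩ := h
  have hfi : Function.Injective f := Set.injOn_univ.1 hf
  intro hH
  have hVr : ∀ x, f x ∈ V(H) := fun x => hV ⟨x, Set.mem_univ x, rfl⟩
  refine (hH (f '' Set.range Sum.inr) ?_ ?_).2 (f '' Set.range Sum.inl)
    (hE ⟨_, Or.inr rfl, rfl⟩) ?_
  · rintro _ ⟨x, -, rfl⟩
    exact hVr x
  · rw [Set.ncard_image_of_injective _ hfi, Set.ncard_range_of_injective Sum.inr_injective]
    simp
  · rintro _ ⟨_, ⟨i, rfl⟩, rfl⟩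
    have hi : (Sum.inl i : Fin r ⊕ Fin (r - 1)) ∉ Set.range (Sum.inr : Fin (r - 1) → _) := by
      simp
    refine ⟨f '' insert (Sum.inl i) (Set.range Sum.inr), hE ⟨_, Or.inl ⟨?_, ?_⟩, rfl⟩,
      Set.image_mono (Set.subset_insert _ _), Set.mem_image_of_mem f (Set.mem_insert _ _), ?_⟩
    · rw [Set.ncard_insert_of_notMem hi, Set.ncard_range_of_injective Sum.inr_injective]
      simp; lia
    · exact Set.subset_insert _ _
    · rwa [hfi.mem_set_image]

/-- An edge e inside the neighborhood of R is disjoint from R and all the sets R + x with x ∈ e are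
edges: e plays the r-set of T_r and R the (r-1)-set. -/
theorem contains_T_of_not_hasIndepNbhds (hr : 2 ≤ r) (hH : H.IsRGraph r)
    (h : ¬ H.HasIndepNbhds r) : H.Contains (T r) := by
  simp only [HasIndepNbhds, IsIndepSet, nbhd_subset_vertexSet, true_and, not_forall,
    not_not] at h
  obtain ⟨R, hRV, hR, e, he, heN⟩ := h
  have her := hH.2 e he
  have hef : e.Finite := Set.finite_of_ncard_pos (by lia)
  have hRf : R.Finite := Set.finite_of_ncard_pos (by lia)
  have : Finite e := hef
  have : Finite R := hRf
  let g : Fin r ≃ e := (Finite.equivFinOfCardEq (by rwa [Nat.card_coe_set_eq])).symm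
  let g' : Fin (r - 1) ≃ R := (Finite.equivFinOfCardEq (by rwa [Nat.card_coe_set_eq])).symm
  have hnb : ∀ x ∈ e, x ∉ R ∧ insert x R ∈ E(H) := fun x hx =>
    insert_mem_edgeSet_of_mem_nbhd (by lia) hH hR (heN hx)
  let f : Fin r ⊕ Fin (r - 1) → α := Sum.elim (fun i => (g i : α)) fun j => (g' j : α)
  have hl : f '' Set.range Sum.inl = e := by
    rw [← Set.range_comp]
    change Set.range (fun i => (g i : α)) = e
    rw [show (fun i => (g i : α)) = Subtype.val ∘ g from rfl, g.surjective.range_comp,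
      Subtype.range_coe]
  have hrr : f '' Set.range Sum.inr = R := by
    rw [← Set.range_comp]
    change Set.range (fun i => (g' i : α)) = R
    rw [show (fun i => (g' i : α)) = Subtype.val ∘ g' from rfl, g'.surjective.range_comp,
      Subtype.range_coe]
  have hfi : Function.Injective f := by
    refine Function.Injective.sumElim (Subtype.val_injective.comp g.injective)
      (Subtype.val_injective.comp g'.injective) fun i j hij => ?_
    have h1 := (hnb (g i) (g i).2).1
    have h2 : (g i : α) = g' j := hij
    rw [h2] at h1
    exact h1 (g' j).2
  refine ⟨f, hfi.injOn, ?_, ?_⟩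
  · rintro _ ⟨i | j, -, rfl⟩
    · exact he.subset_vertexSet (g i).2
    · exact hRV (g' j).2
  · rintro _ ⟨e', he' | he', rfl⟩
    · obtain ⟨hc, hS⟩ := he'
      have hSc : (Set.range (Sum.inr : Fin (r - 1) → Fin r ⊕ Fin (r - 1))).ncard = r - 1 := by
        rw [Set.ncard_range_of_injective Sum.inr_injective]; simp
      obtain ⟨x, hx⟩ : (e' \ Set.range Sum.inr).Nonempty := by
        rw [Set.sdiff_nonempty]
        intro hsub
        have := Set.ncard_le_ncard hsub
        lia
      obtain ⟨i, rfl⟩ : ∃ i, Sum.inl i = x := by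
        rcases x with i | j
        · exact ⟨i, rfl⟩
        · exact absurd ⟨j, rfl⟩ hx.2
      rw [eq_insert_of_mem_sdiff (by lia) hc hSc hS hx, Set.image_insert_eq, hrr]
      exact (hnb (g i) (g i).2).2
    · rw [Set.mem_singleton_iff.1 he', hl]
      exact he

theorem hasIndepNbhds_iff_not_contains_T (hr : 2 ≤ r) (hH : H.IsRGraph r) :
    H.HasIndepNbhds r ↔ ¬ H.Contains (T r) :=
  ⟨fun h hc => hc.not_hasIndepNbhds (by lia) h,
    fun h => not_not.1 fun hn => h (contains_T_of_not_hasIndepNbhds hr hH hn)⟩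

/-! ### The independence number -/

open Classical in
/-- The edges of a hypergraph inside the finite set `V`, as a family of finsets. -/
noncomputable def edgeFamily (H : Hypergraph α) (V : Finset α) : Finset (Finset α) :=
  {e ∈ V.powerset | (e : Set α) ∈ E(H)}

theorem mem_edgeFamily {V e : Finset α} (hV : (V : Set α) = V(H)) :
    e ∈ H.edgeFamily V ↔ (e : Set α) ∈ E(H) := by
  classical
  simp only [edgeFamily, Finset.mem_filter, Finset.mem_powerset, and_iff_right_iff_imp]
  intro he
  rw [← Finset.coe_subset, hV]
  exact he.subset_vertexSet

open Classical in
theorem HasIndepNbhds.card_filter_superset_le (hr : 2 ≤ r) (hH : H.IsRGraph r)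
    (hN : H.HasIndepNbhds r) {V : Finset α} (hV : (V : Set α) = V(H)) {R : Finset α}
    (hR : R.card = r - 1) : {e ∈ H.edgeFamily V | R ⊆ e}.card ≤ H.indepNum := by
  rcases Finset.eq_empty_or_nonempty {e ∈ H.edgeFamily V | R ⊆ e} with h | ⟨e, he⟩
  · simp [h]
  obtain ⟨he, hRe⟩ := Finset.mem_filter.1 he
  rw [mem_edgeFamily hV] at he
  have hRV : (R : Set α) ⊆ V(H) := (Finset.coe_subset.2 hRe).trans he.subset_vertexSet
  have hRc : (R : Set α).ncard = r - 1 := by rw [Set.ncard_coe_finset, hR]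
  have hind := hN R hRV hRc
  have hfin : (H.nbhd R).Finite := hH.1.subset hind.1
  refine le_trans ?_ (hind.ncard_le_indepNum hH.1)
  rw [Set.ncard_eq_toFinset_card _ hfin]
  refine (Finset.card_le_card (t := hfin.toFinset.image fun x => insert x R) ?_).trans
    Finset.card_image_le
  intro e' he'
  obtain ⟨he', hRe'⟩ := Finset.mem_filter.1 he'
  rw [mem_edgeFamily hV] at he'
  have hc := hH.2 _ he'
  obtain ⟨x, hxe, hxR⟩ := Finset.exists_mem_notMem_of_card_lt_card (s := R) (t := e')
    (by rw [Set.ncard_coe_finset] at hc; lia)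
  refine Finset.mem_image.2 ⟨x, ?_, ?_⟩
  · rw [Set.Finite.mem_toFinset]
    exact ⟨e', he', Finset.coe_subset.2 hRe', hxe, hxR⟩
  · have := eq_insert_of_mem_sdiff (by lia) hc hRc (Finset.coe_subset.2 hRe') ⟨hxe, hxR⟩
    rw [← Finset.coe_inj, Finset.coe_insert, this]

-- For graphs the link of v consists of neighbors of v, so an edge with two vertices there would
-- form a triangle.
open Classical in
theorem HasIndepNbhds.locallySparse (hH : H.IsRGraph 2) (hN : H.HasIndepNbhds 2) {V : Finset α}
    (hV : (V : Set α) = V(H)) {U : Finset α} {v : α} (hv : v ∉ U) :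
    FinsetFamily.LocallySparse (H.edgeFamily V) U v := by
  intro f hf hfU x hx y hy hxN hyN
  by_contra hxy
  rw [mem_edgeFamily hV] at hf
  have key : ∀ z ∈ FinsetFamily.linkVerts (H.edgeFamily V) U v,
      v ∈ V(H) ∧ z ∈ H.nbhd {v} := by
    intro z hz
    obtain ⟨hzU, e, he, hze⟩ := Finset.mem_filter.1 hz
    obtain ⟨heE, hve, -⟩ := Finset.mem_filter.1 he
    rw [mem_edgeFamily hV] at heE
    refine ⟨heE.subset_vertexSet hve, e, heE, Set.singleton_subset_iff.2 hve, hze, ?_⟩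
    rintro rfl
    exact hv hzU
  refine (hN {v} (Set.singleton_subset_iff.2 (key x hxN).1) (by simp)).2 f hf ?_
  have hfc := hH.2 _ hf
  rw [Set.ncard_coe_finset] at hfc
  have hpair : {x, y} = f := by
    refine Finset.eq_of_subset_of_card_le ?_ (by rw [hfc, Finset.card_pair hxy])
    intro z hz
    simp only [Finset.mem_insert, Finset.mem_singleton] at hz
    rcases hz with rfl | rfl <;> assumption
  rw [← hpair]
  intro z hz
  simp only [Finset.coe_insert, Finset.coe_singleton, Set.mem_insert_iff,
    Set.mem_singleton_iff] at hz
  rcases hz with rfl | rfl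
  · exact (key _ hxN).2
  · exact (key _ hyN).2

theorem exists_const_le_indepNum (r : ℕ) (hr : 2 ≤ r) : ∃ c : ℝ, 0 < c ∧
    ∀ (α : Type*) (H : Hypergraph α) (n : ℕ),
      H.IsRGraph r → V(H).ncard = n → H.HasIndepNbhds r →
        c * ((n : ℝ) * Real.log n) ^ ((1 : ℝ) / r) ≤ (H.indepNum : ℝ) := by
  classical
  obtain ⟨b, rfl⟩ : ∃ b, r = b + 1 := ⟨r - 1, by lia⟩
  obtain ⟨c, hc, h⟩ := FinsetFamily.exists_const_le_of_codegree_le b (by lia)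
  refine ⟨c, hc, fun α H n hH hn hN => ?_⟩
  set V := hH.1.toFinset with hVdef
  have hV : (V : Set α) = V(H) := hH.1.coe_toFinset
  have hcard : V.card = n := by rw [← hn, Set.ncard_eq_toFinset_card _ hH.1]
  rw [← hcard]
  refine h (H.edgeFamily V) V H.indepNum ?_ ?_ ?_ ?_ ?_
  · intro e he
    rw [← Set.ncard_coe_finset]
    exact hH.2 _ ((mem_edgeFamily hV).1 he)
  · intro e he
    exact Finset.mem_powerset.1 (Finset.mem_filter.1 he).1
  · intro R hR
    exact hN.card_filter_superset_le hr hH hV hR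
  · intro W hW
    obtain ⟨hWV, hW⟩ := FinsetFamily.mem_indepSets.1 hW
    rw [← Set.ncard_coe_finset]
    refine IsIndepSet.ncard_le_indepNum hH.1 ⟨by rw [← hV]; exact_mod_cast hWV, fun e he heW => ?_⟩
    have hef : e.Finite := hH.1.subset he.subset_vertexSet
    refine hW hef.toFinset ((mem_edgeFamily hV).2 (by rwa [hef.coe_toFinset])) ?_
    rwa [← Finset.coe_subset, hef.coe_toFinset]
  · rintro rfl U v hv
    exact hN.locallySparse hH hV hv

/-! ### Ramsey numbers -/

theorem isRGraph_colorClass (r N : ℕ) {κ : Type*} (c : E(completeRGraph r N) → κ) (i : κ) :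
    ((completeRGraph r N).colorClass c i).IsRGraph r :=
  ⟨Set.toFinite _, fun _ he => he.1⟩

theorem contains_completeRGraph_of_le_indepNum {r N t : ℕ} (hr : 1 ≤ r)
    (c : E(completeRGraph r N) → Bool)
    (h : t ≤ ((completeRGraph r N).colorClass c true).indepNum) :
    ((completeRGraph r N).colorClass c false).Contains (completeRGraph r t) := by
  obtain ⟨Z, hZ, hZc⟩ := exists_isIndepSet_ncard_eq_indepNum
    (H := (completeRGraph r N).colorClass c true) (Set.toFinite _) fun e he =>
      Set.nonempty_of_ncard_ne_zero (by rw [(isRGraph_colorClass r N c true).2 e he]; lia)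
  rw [← hZc, ← Nat.card_coe_set_eq, ← Nat.card_fin t] at h
  obtain ⟨g⟩ : Nonempty (Fin t ↪ Z) := by
    have := Fintype.ofFinite Z
    rw [Nat.card_eq_fintype_card, Nat.card_eq_fintype_card] at h
    exact Function.Embedding.nonempty_of_card_le h
  have hgi : Function.Injective fun i => (g i : Fin N) := Subtype.val_injective.comp g.injective
  refine ⟨fun i => (g i : Fin N), hgi.injOn, Set.subset_univ _, ?_⟩
  rintro _ ⟨e, he, rfl⟩
  have he' : ((fun i => (g i : Fin N)) '' e) ∈ E(completeRGraph r N) := by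
    change Set.ncard _ = r
    rw [Set.ncard_image_of_injective _ hgi]
    exact he
  refine ⟨he', ?_⟩
  rw [← Bool.not_eq_true]
  intro hred
  refine hZ.2 _ ⟨he', hred⟩ ?_
  rintro _ ⟨i, -, rfl⟩
  exact (g i).2

theorem exists_ramseyNumber_le (r : ℕ) (hr : 2 ≤ r) : ∃ C : ℝ, 0 < C ∧ ∀ t : ℕ, 2 ≤ t →
    (ramseySet r (T r) (completeRGraph r t)).Nonempty ∧
    (ramseyNumber r (T r) (completeRGraph r t) : ℝ) ≤ C * ((t : ℝ) ^ r / Real.log t) := by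
  obtain ⟨c, hc, hα⟩ := exists_const_le_indepNum.{0} r hr
  set C₀ : ℝ := max 1 ((1 / c) ^ r) with hC₀
  have hC1 : 1 ≤ C₀ := le_max_left _ _
  -- The factor (1/c)^r in C₀ makes c (N log N)^(1/r) ≥ t, the bound C₀ ≥ 1 gives N ≥ t and so log N
  -- ≥ log t, and the extra 1 pays for rounding up since X ≥ t ≥ 1.
  refine ⟨C₀ + 1, by linarith, fun t ht => ?_⟩
  have ht' : (2 : ℝ) ≤ t := by exact_mod_cast ht
  have hlog : 0 < Real.log t := Real.log_pos (by linarith)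
  have hlogt : Real.log t ≤ t := Real.log_le_self (by linarith)
  set X : ℝ := (t : ℝ) ^ r / Real.log t with hX
  have hXt : (t : ℝ) ≤ X := by
    rw [hX, le_div_iff₀ hlog]
    calc (t : ℝ) * Real.log t ≤ t * t := by gcongr
      _ = (t : ℝ) ^ 2 := by ring
      _ ≤ (t : ℝ) ^ r := pow_le_pow_right₀ (by linarith) hr
  set N : ℕ := ⌈C₀ * X⌉₊ with hN
  have hNX : C₀ * X ≤ N := Nat.le_ceil _
  have hNt : (t : ℝ) ≤ N := by nlinarith
  have hmem : N ∈ ramseySet r (T r) (completeRGraph r t) := by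
    intro col
    by_contra! hcon
    obtain ⟨h1, h2⟩ := hcon
    have hR := isRGraph_colorClass r N col true
    have hlow := hα _ _ N hR (by simp [colorClass, completeRGraph, Set.ncard_univ])
      ((hasIndepNbhds_iff_not_contains_T hr hR).2 h1)
    refine h2 (contains_completeRGraph_of_le_indepNum (by lia) col ?_)
    rw [← Nat.cast_le (α := ℝ)]
    refine le_trans ?_ hlow
    have hNlog : ((t : ℝ) / c) ^ r ≤ N * Real.log N := by
      calc ((t : ℝ) / c) ^ r = (1 / c) ^ r * X * Real.log t := by
            rw [hX, mul_assoc, div_mul_cancel₀ _ hlog.ne', ← mul_pow, one_div_mul_eq_div]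
        _ ≤ C₀ * X * Real.log t := by
            gcongr
            exact le_max_right _ _
        _ ≤ N * Real.log N := by gcongr
    have hr0 : (r : ℝ) ≠ 0 := by positivity
    calc (t : ℝ) = c * (((t : ℝ) / c) ^ r) ^ ((1 : ℝ) / r) := by
          rw [← Real.rpow_natCast, ← Real.rpow_mul (by positivity), mul_one_div_cancel hr0,
            Real.rpow_one]
          field_simp
      _ ≤ _ := by gcongr
  refine ⟨⟨N, hmem⟩, ?_⟩
  have h1 : (ramseyNumber r (T r) (completeRGraph r t) : ℝ) ≤ N := by
    exact_mod_cast Nat.sInf_le hmem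
  have h2 : (N : ℝ) < C₀ * X + 1 := Nat.ceil_lt_add_one (by positivity)
  nlinarith

end Hypergraph

theorem theorem2 (r : ℕ) (hr : 2 ≤ r) :
    (∀ (α : Type*) (H : Hypergraph α), H.IsRGraph r →
      (H.HasIndepNbhds r ↔ ¬ H.Contains (Hypergraph.T r))) ∧
    (∃ c : ℝ, 0 < c ∧ ∀ (α : Type*) (H : Hypergraph α) (n : ℕ),
      H.IsRGraph r → H.vertexSet.ncard = n → H.HasIndepNbhds r →
        c * ((n : ℝ) * Real.log n) ^ ((1 : ℝ) / r) ≤ (H.indepNum : ℝ)) ∧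
    (∃ C : ℝ, 0 < C ∧ ∀ t : ℕ, 2 ≤ t →
      (Hypergraph.ramseySet r (Hypergraph.T r) (Hypergraph.completeRGraph r t)).Nonempty ∧
      (Hypergraph.ramseyNumber r (Hypergraph.T r) (Hypergraph.completeRGraph r t) : ℝ) ≤
        C * ((t : ℝ) ^ r / Real.log t)) :=
  ⟨fun _ _ hH => Hypergraph.hasIndepNbhds_iff_not_contains_T hr hH,
    Hypergraph.exists_const_le_indepNum r hr, Hypergraph.exists_ramseyNumber_le r hr⟩
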